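/- There is a universal constant $c>0.1798$ with the following property. Let $n\ge 0$, let $\Omega_1,\dots,\Omega_n$ be finite sets, and for each $i$ let $P_i$ and $Q_i$ be probability distributions on $\Omega_i$. For distributions $P,Q$ on a finite set $\Omega$ write $\mathrm{TV}(P,Q)=\frac12\sum_{\omega\in\Omega}|P(\omega)-Q(\omega)|$, let $P^\otimes_{1:n}=P_1\otimes\cdots\otimes P_n$ and $Q^\otimes_{1:n}=Q_1\otimes\cdots\otimes Q_n$ be the product measures on $\Omega_1\times\cdots\times\Omega_n$, and let $\boldsymbol\delta=(\mathrm{TV}(P_1,Q_1),\dots,\mathrm{TV}(P_n,Q_n))\in\mathbb{R}^n$. Then $$\mathrm{TV}(P^\otimes_{1:n},Q^\otimes_{1:n})\ \ge\ c\,\min\{1,\|\boldsymbol\delta\|_2\},$$ where $\|\boldsymbol\delta\|_2=\big(\sum_{i=1}^n\mathrm{TV}(P_i,Q_i)^2\big)^{1/2}$. -/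

import Mathlib

open MeasureTheory

/-- The total variation distance `(1/2) ∑ ω, |P(ω) - Q(ω)|` of two distributions on a finite set,
where `P(ω) = P({ω})`. -/
noncomputable def tvDist {α : Type*} [Fintype α] [MeasurableSpace α] (P Q : Measure α) : ℝ :=
  (1 / 2) * ∑ ω : α, |P.real {ω} - Q.real {ω}|

/-- The vector of marginal total variation distances of two families of distributions, as an
element of Euclidean space, so that its norm is the `ℓ²` norm. -/
noncomputable def marginalTV {n : ℕ} {Ω : Fin n → Type*} [∀ i, Fintype (Ω i)]
    [∀ i, MeasurableSpace (Ω i)] (P Q : ∀ i, Measure (Ω i)) : EuclideanSpace ℝ (Fin n) :=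
  WithLp.toLp 2 fun i => tvDist (P i) (Q i)

/-!
A product of complex test functions `ψ i` of modulus at most `1` has expectations `∏ i, z i` and
`∏ i, conj (z i)` under the two product measures as soon as `P i` and `Q i` give `ψ i` the conjugate
expectations `z i` and `conj (z i)`; hence `Im ∏ i, z i` is a lower bound for the distance.
For `y` in `[0, 1]`, one can reach `z i = √(1 - y ^ 2) + I * y * tvDist (P i) (Q i) / 2`. Imaginary
parts add up to first order under multiplication, whereas the real parts only lose a factor
`√(1 - ∑ i, y i ^ 2)`, so the best `y` of prescribed Euclidean norm is parallel to the vector of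
marginal distances.
-/

open scoped ComplexConjugate

theorem one_sub_sum_le_prod_one_sub {ι : Type*} {s : Finset ι} {x : ι → ℝ}
    (h0 : ∀ i ∈ s, 0 ≤ x i) (h1 : ∀ i ∈ s, x i ≤ 1) :
    1 - ∑ i ∈ s, x i ≤ ∏ i ∈ s, (1 - x i) := by
  induction s using Finset.cons_induction with
  | empty => simp
  | cons j s hj ih =>
    rw [Finset.forall_mem_cons] at h0 h1
    rw [Finset.sum_cons, Finset.prod_cons]
    have hs : 0 ≤ ∑ i ∈ s, x i := Finset.sum_nonneg h0.2
    calc 1 - (x j + ∑ i ∈ s, x i) ≤ (1 - x j) * (1 - ∑ i ∈ s, x i) := by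
          linarith [mul_nonneg h0.1 hs]
      _ ≤ (1 - x j) * ∏ i ∈ s, (1 - x i) :=
          mul_le_mul_of_nonneg_left (ih h0.2 h1.2) (sub_nonneg.2 h1.1)

theorem sqrt_one_sub_sum_sq_le_prod_sqrt {ι : Type*} {s : Finset ι} {y : ι → ℝ}
    (hy : ∀ i ∈ s, y i ^ 2 ≤ 1) :
    √(1 - ∑ i ∈ s, y i ^ 2) ≤ ∏ i ∈ s, √(1 - y i ^ 2) := by
  rw [← Real.sqrt_prod s fun i hi => sub_nonneg.2 (hy i hi)]
  exact Real.sqrt_le_sqrt (one_sub_sum_le_prod_one_sub (fun i _ => sq_nonneg (y i)) hy)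

section ComplexProduct

variable {ι : Type*} {s : Finset ι} {z : ι → ℂ}

theorem im_prod_le_sum_im (hre : ∀ i ∈ s, 0 ≤ (z i).re) (him : ∀ i ∈ s, 0 ≤ (z i).im)
    (hz : ∀ i ∈ s, ‖z i‖ ≤ 1) : (∏ i ∈ s, z i).im ≤ ∑ i ∈ s, (z i).im := by
  induction s using Finset.cons_induction with
  | empty => simp
  | cons j s hj ih =>
    rw [Finset.forall_mem_cons] at hre him hz
    rw [Finset.prod_cons, Finset.sum_cons, Complex.mul_im]
    have hprod : (∏ i ∈ s, z i).re ≤ 1 := by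
      refine (Complex.re_le_norm _).trans ?_
      rw [norm_prod]
      exact Finset.prod_le_one (fun _ _ => norm_nonneg _) hz.2
    have hre_mul : (z j).re * (∏ i ∈ s, z i).im ≤ ∑ i ∈ s, (z i).im :=
      calc (z j).re * (∏ i ∈ s, z i).im ≤ (z j).re * ∑ i ∈ s, (z i).im :=
            mul_le_mul_of_nonneg_left (ih hre.2 him.2 hz.2) hre.1
        _ ≤ ∑ i ∈ s, (z i).im :=
            mul_le_of_le_one_left (Finset.sum_nonneg him.2) ((Complex.re_le_norm _).trans hz.1)
    linarith [mul_le_of_le_one_right him.1 hprod]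

theorem prod_re_sub_le_re_prod (hre : ∀ i ∈ s, 0 ≤ (z i).re) (him : ∀ i ∈ s, 0 ≤ (z i).im)
    (hz : ∀ i ∈ s, ‖z i‖ ≤ 1) :
    ∏ i ∈ s, (z i).re - (∑ i ∈ s, (z i).im) ^ 2 / 2 ≤ (∏ i ∈ s, z i).re := by
  induction s using Finset.cons_induction with
  | empty => simp
  | cons j s hj ih =>
    rw [Finset.forall_mem_cons] at hre him hz
    rw [Finset.prod_cons, Finset.prod_cons, Finset.sum_cons, Complex.mul_re]
    set B := ∑ i ∈ s, (z i).im
    have hre_one : (z j).re ≤ 1 := (Complex.re_le_norm _).trans hz.1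
    have hre_mul := mul_le_mul_of_nonneg_left (ih hre.2 him.2 hz.2) hre.1
    have him_mul : (z j).im * (∏ i ∈ s, z i).im ≤ (z j).im * B :=
      mul_le_mul_of_nonneg_left (im_prod_le_sum_im hre.2 him.2 hz.2) him.1
    linarith [mul_le_of_le_one_left (sq_nonneg B) hre_one, sq_nonneg (z j).im]

theorem sum_im_mul_le_im_prod (hre : ∀ i ∈ s, 0 ≤ (z i).re) (him : ∀ i ∈ s, 0 ≤ (z i).im)
    (hz : ∀ i ∈ s, ‖z i‖ ≤ 1) :
    (∑ i ∈ s, (z i).im) * (∏ i ∈ s, (z i).re - (∑ i ∈ s, (z i).im) ^ 2 / 2) ≤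
      (∏ i ∈ s, z i).im := by
  induction s using Finset.cons_induction with
  | empty => simp
  | cons j s hj ih =>
    rw [Finset.forall_mem_cons] at hre him hz
    rw [Finset.prod_cons, Finset.prod_cons, Finset.sum_cons, Complex.mul_im]
    set a := (z j).re
    set b := (z j).im
    set A := ∏ i ∈ s, (z i).re
    set B := ∑ i ∈ s, (z i).im
    have ha0 : 0 ≤ a := hre.1
    have hb : 0 ≤ b := him.1
    have ha : a ≤ 1 := (Complex.re_le_norm _).trans hz.1
    have hA : 0 ≤ A := Finset.prod_nonneg hre.2
    have hB : 0 ≤ B := Finset.sum_nonneg him.2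
    have hbA : a * (b * A) ≤ b * A := mul_le_of_le_one_left (by positivity) ha
    have hB3 : a * B ^ 3 ≤ B ^ 3 := mul_le_of_le_one_left (by positivity) ha
    have hcube : B ^ 3 + b * B ^ 2 ≤ (b + B) ^ 3 := by
      have : 0 ≤ b ^ 3 + 3 * b ^ 2 * B + 2 * b * B ^ 2 := by positivity
      linarith
    calc (b + B) * (a * A - (b + B) ^ 2 / 2)
        ≤ a * (B * (A - B ^ 2 / 2)) + b * (A - B ^ 2 / 2) := by linarith
      _ ≤ a * (∏ i ∈ s, z i).im + b * (∏ i ∈ s, z i).re := by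
          gcongr
          · exact ih hre.2 him.2 hz.2
          · exact prod_re_sub_le_re_prod hre.2 him.2 hz.2

end ComplexProduct

section SingleSpace

variable {α : Type*} [Fintype α] [MeasurableSpace α]

theorem tvDist_nonneg (P Q : Measure α) : 0 ≤ tvDist P Q :=
  mul_nonneg (by norm_num) (Finset.sum_nonneg fun _ _ => abs_nonneg _)

variable [MeasurableSingletonClass α]

theorem norm_integral_sub_integral_le_two_mul_tvDist {E : Type*} [NormedAddCommGroup E]
    [NormedSpace ℝ E] [CompleteSpace E] (P Q : Measure α) [IsFiniteMeasure P] [IsFiniteMeasure Q]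
    {ψ : α → E} (hψ : ∀ x, ‖ψ x‖ ≤ 1) : ‖∫ x, ψ x ∂P - ∫ x, ψ x ∂Q‖ ≤ 2 * tvDist P Q := by
  rw [integral_fintype .of_finite, integral_fintype .of_finite, ← Finset.sum_sub_distrib]
  calc ‖∑ x, (P.real {x} • ψ x - Q.real {x} • ψ x)‖ ≤ ∑ x, |P.real {x} - Q.real {x}| := by
        refine norm_sum_le_of_le _ fun x _ => ?_
        rw [← sub_smul, norm_smul, Real.norm_eq_abs]
        exact mul_le_of_le_one_right (abs_nonneg _) (hψ x)
    _ = 2 * tvDist P Q := by rw [tvDist]; ring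

variable (P Q : Measure α) [IsProbabilityMeasure P] [IsProbabilityMeasure Q]

theorem exists_tvDist_eq_measureReal_sub : ∃ A : Set α, tvDist P Q = P.real A - Q.real A := by
  classical
  set A : Finset α := {x | Q.real {x} ≤ P.real {x}} with hA
  have hpos : ∑ x ∈ A, |P.real {x} - Q.real {x}| = P.real A - Q.real A := by
    rw [← sum_measureReal_singleton, ← sum_measureReal_singleton, ← Finset.sum_sub_distrib]
    exact Finset.sum_congr rfl fun x hx =>
      abs_of_nonneg (sub_nonneg.2 (Finset.mem_filter.1 hx).2)
  have hneg : ∑ x ∈ Aᶜ, |P.real {x} - Q.real {x}| = P.real A - Q.real A := by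
    calc ∑ x ∈ Aᶜ, |P.real {x} - Q.real {x}| = ∑ x ∈ Aᶜ, (Q.real {x} - P.real {x}) := by
          refine Finset.sum_congr rfl fun x hx => ?_
          have hlt : P.real {x} < Q.real {x} := by simpa [hA] using hx
          rw [abs_sub_comm, abs_of_pos (sub_pos.2 hlt)]
      _ = Q.real (A : Set α)ᶜ - P.real (A : Set α)ᶜ := by
          rw [Finset.sum_sub_distrib, sum_measureReal_singleton, sum_measureReal_singleton,
            Finset.coe_compl]
      _ = P.real A - Q.real A := by
          rw [probReal_compl_eq_one_sub A.measurableSet, probReal_compl_eq_one_sub A.measurableSet]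
          ring
  refine ⟨A, ?_⟩
  rw [tvDist, ← Finset.sum_add_sum_compl A, hpos, hneg]
  ring

theorem exists_integral_eq_half_tvDist :
    ∃ g : α → ℝ, (∀ x, |g x| ≤ 1) ∧
      ∫ x, g x ∂P = tvDist P Q / 2 ∧ ∫ x, g x ∂Q = -(tvDist P Q / 2) := by
  obtain ⟨A, hA⟩ := exists_tvDist_eq_measureReal_sub P Q
  have hmeas : MeasurableSet A := A.toFinite.measurableSet
  set m := (P.real A + Q.real A) / 2 with hm
  have hm0 : 0 ≤ m := by positivity
  have hm1 : m ≤ 1 := by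
    have hP : P.real A ≤ 1 := measureReal_le_one
    have hQ : Q.real A ≤ 1 := measureReal_le_one
    linarith
  have hint (μ : Measure α) [IsProbabilityMeasure μ] :
      ∫ x, (A.indicator 1 x - m) ∂μ = μ.real A - m := by
    rw [integral_sub .of_finite .of_finite, integral_indicator_one hmeas]
    simp
  refine ⟨fun x => A.indicator 1 x - m, fun x => ?_, ?_, ?_⟩
  · simp only [abs_le]
    by_cases hx : x ∈ A
    · rw [Set.indicator_of_mem hx, Pi.one_apply]
      constructor <;> linarith
    · rw [Set.indicator_of_notMem hx]
      constructor <;> linarith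
  · rw [hint P, hA, hm]; ring
  · rw [hint Q, hA, hm]; ring

theorem exists_integral_eq_conj {y : ℝ} (hy : y ^ 2 ≤ 1) :
    ∃ ψ : α → ℂ, (∀ x, ‖ψ x‖ ≤ 1) ∧
      ∫ x, ψ x ∂P = ⟨√(1 - y ^ 2), y * tvDist P Q / 2⟩ ∧
      ∫ x, ψ x ∂Q = conj (∫ x, ψ x ∂P) := by
  obtain ⟨g, hg, hgP, hgQ⟩ := exists_integral_eq_half_tvDist P Q
  set a := √(1 - y ^ 2)
  have ha : a ^ 2 = 1 - y ^ 2 := Real.sq_sqrt (sub_nonneg.2 hy)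
  have hint (μ : Measure α) [IsProbabilityMeasure μ] :
      ∫ x, (⟨a, y * g x⟩ : ℂ) ∂μ = ⟨a, y * ∫ x, g x ∂μ⟩ := by
    apply Complex.ext
    · rw [← RCLike.re_eq_complex_re, ← integral_re .of_finite]
      simp
    · rw [← RCLike.im_eq_complex_im, ← integral_im .of_finite]
      simp [integral_const_mul]
  refine ⟨fun x => ⟨a, y * g x⟩, fun x => ?_, by rw [hint, hgP, mul_div_assoc], ?_⟩
  · have hgx : g x ^ 2 ≤ 1 := (sq_le_one_iff_abs_le_one _).2 (hg x)
    rw [← sq_le_one_iff₀ (norm_nonneg _), Complex.sq_norm, Complex.normSq_mk]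
    linarith [mul_le_of_le_one_right (sq_nonneg y) hgx]
  · rw [hint, hint, hgP, hgQ]
    apply Complex.ext <;> simp

end SingleSpace

section ProductSpace

variable {ι : Type*} [Fintype ι]

theorem exists_sum_sq_le_one_sum_mul_eq_min {δ : ι → ℝ} (hδ : ∀ i, 0 ≤ δ i) :
    ∃ w : ι → ℝ, (∀ i, 0 ≤ w i) ∧ ∑ i, w i ^ 2 ≤ 1 ∧
      ∑ i, w i * δ i = min 1 √(∑ i, δ i ^ 2) := by
  set r := √(∑ i, δ i ^ 2) with hr
  have hsq : ∑ i, δ i ^ 2 = r ^ 2 := (Real.sq_sqrt (by positivity)).symm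
  obtain hr0 | hrpos := (Real.sqrt_nonneg (∑ i, δ i ^ 2)).eq_or_lt
  · exact ⟨0, by simp, by simp, by simp [hr, ← hr0]⟩
  rw [← hr] at hrpos
  refine ⟨fun i => min 1 r / r ^ 2 * δ i, fun i => mul_nonneg (by positivity) (hδ i), ?_, ?_⟩
  · have hratio : min 1 r / r ≤ 1 := (div_le_one hrpos).2 (min_le_right 1 r)
    calc ∑ i, (min 1 r / r ^ 2 * δ i) ^ 2 = (min 1 r / r) ^ 2 := by
          simp_rw [mul_pow, ← Finset.mul_sum, hsq]
          field_simp
      _ ≤ 1 := pow_le_one₀ (by positivity) hratio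
  · simp_rw [mul_assoc, ← sq, ← Finset.mul_sum, hsq]
    field_simp

variable [DecidableEq ι] {Ω : ι → Type*} [∀ i, Fintype (Ω i)] [∀ i, MeasurableSpace (Ω i)]
  [∀ i, MeasurableSingletonClass (Ω i)] (P Q : ∀ i, Measure (Ω i))

theorem im_prod_integral_le_tvDist_pi [∀ i, IsFiniteMeasure (P i)] [∀ i, IsFiniteMeasure (Q i)]
    {ψ : ∀ i, Ω i → ℂ} (hψ : ∀ i x, ‖ψ i x‖ ≤ 1)
    (hconj : ∀ i, ∫ x, ψ i x ∂Q i = conj (∫ x, ψ i x ∂P i)) :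
    (∏ i, ∫ x, ψ i x ∂P i).im ≤ tvDist (Measure.pi P) (Measure.pi Q) := by
  have hΨ (ω : ∀ i, Ω i) : ‖∏ i, ψ i (ω i)‖ ≤ 1 := by
    rw [norm_prod]
    exact Finset.prod_le_one (fun _ _ => norm_nonneg _) fun i _ => hψ i (ω i)
  have hle := norm_integral_sub_integral_le_two_mul_tvDist (Measure.pi P) (Measure.pi Q) hΨ
  simp_rw [integral_fintype_prod_eq_prod, hconj, ← map_prod] at hle
  have him := (Complex.im_le_norm _).trans hle
  rw [Complex.sub_im, Complex.conj_im] at him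
  linarith

variable [∀ i, IsProbabilityMeasure (P i)] [∀ i, IsProbabilityMeasure (Q i)]

theorem half_sum_mul_le_tvDist_pi {y : ι → ℝ} (hy0 : ∀ i, 0 ≤ y i) (hy1 : ∀ i, y i ^ 2 ≤ 1) :
    (∑ i, y i * tvDist (P i) (Q i)) / 2 *
        (√(1 - ∑ i, y i ^ 2) - ((∑ i, y i * tvDist (P i) (Q i)) / 2) ^ 2 / 2) ≤
      tvDist (Measure.pi P) (Measure.pi Q) := by
  choose ψ hψ hψP hψQ using fun i => exists_integral_eq_conj (P i) (Q i) (hy1 i)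
  have hmul (i) : 0 ≤ y i * tvDist (P i) (Q i) := mul_nonneg (hy0 i) (tvDist_nonneg _ _)
  have hnorm (i) : ‖∫ x, ψ i x ∂P i‖ ≤ 1 := by
    simpa using norm_integral_le_of_norm_le_const (μ := P i) (.of_forall (hψ i))
  have hprod := sum_im_mul_le_im_prod (s := Finset.univ) (z := fun i => ∫ x, ψ i x ∂P i)
    (fun i _ => by rw [hψP]; exact Real.sqrt_nonneg _)
    (fun i _ => by rw [hψP]; exact div_nonneg (hmul i) zero_le_two) fun i _ => hnorm i
  refine le_trans ?_ (hprod.trans (im_prod_integral_le_tvDist_pi P Q hψ hψQ))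
  simp only [hψP, ← Finset.sum_div]
  gcongr
  · exact div_nonneg (Finset.sum_nonneg fun i _ => hmul i) zero_le_two
  · exact sqrt_one_sub_sum_sq_le_prod_sqrt fun i _ => hy1 i

theorem theorem1_general :
    1 / 5 * min 1 √(∑ i, tvDist (P i) (Q i) ^ 2) ≤ tvDist (Measure.pi P) (Measure.pi Q) := by
  obtain ⟨w, hw0, hw_sq, hw_mul⟩ :=
    exists_sum_sq_le_one_sum_mul_eq_min fun i => tvDist_nonneg (P i) (Q i)
  set t := min 1 √(∑ i, tvDist (P i) (Q i) ^ 2)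
  have ht0 : 0 ≤ t := by positivity
  have ht1 : t ≤ 1 := min_le_left _ _
  -- Any scale near `2 / 3` is good enough; `3 / 5` makes `√(1 - (3 / 5) ^ 2)` rational.
  set y : ι → ℝ := fun i => 3 / 5 * w i with hy
  have hy_mul : ∑ i, y i * tvDist (P i) (Q i) = 3 / 5 * t := by
    simp_rw [hy, mul_assoc, ← Finset.mul_sum, hw_mul]
  have hy_sq : ∑ i, y i ^ 2 ≤ 9 / 25 := by
    simp_rw [hy, mul_pow, ← Finset.mul_sum]
    linarith
  have hy_le (i) : y i ^ 2 ≤ 1 := by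
    linarith [Finset.single_le_sum (f := fun i => y i ^ 2) (fun i _ => sq_nonneg _)
      (Finset.mem_univ i)]
  have hsqrt : 4 / 5 ≤ √(1 - ∑ i, y i ^ 2) := Real.le_sqrt_of_sq_le (by linarith)
  have ht_sq : t ^ 2 ≤ 1 := pow_le_one₀ ht0 ht1
  have hle := half_sum_mul_le_tvDist_pi P Q (fun i => mul_nonneg (by norm_num) (hw0 i)) hy_le
  rw [hy_mul] at hle
  calc 1 / 5 * t ≤ 3 / 5 * t / 2 * (4 / 5 - 1 / 10) := by linarith
    _ ≤ 3 / 5 * t / 2 * (√(1 - ∑ i, y i ^ 2) - (3 / 5 * t / 2) ^ 2 / 2) := by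
        refine mul_le_mul_of_nonneg_left (sub_le_sub hsqrt ?_) (by positivity)
        linarith
    _ ≤ tvDist (Measure.pi P) (Measure.pi Q) := hle

end ProductSpace

theorem theorem1 :
    ∃ c : ℝ, 0.1798 < c ∧
      ∀ (n : ℕ) (Ω : Fin n → Type*) [∀ i, Fintype (Ω i)] [∀ i, MeasurableSpace (Ω i)]
        [∀ i, MeasurableSingletonClass (Ω i)] (P Q : ∀ i, Measure (Ω i))
        [∀ i, IsProbabilityMeasure (P i)] [∀ i, IsProbabilityMeasure (Q i)],
        c * min 1 ‖marginalTV P Q‖ ≤ tvDist (Measure.pi P) (Measure.pi Q) :=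
  ⟨1 / 5, by norm_num, fun n Ω _ _ _ P Q _ _ => by
    simpa [EuclideanSpace.norm_eq, marginalTV] using theorem1_general P Q⟩
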